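/- For a real normed space $X$ and a linear subspace $Y \subset X$ let $$\lambda(Y,X) = \inf\{\|P\| : P\colon X \to Y \text{ bounded linear},\ P|_Y = \mathrm{id}_Y\}$$ be the relative projection constant of $Y$ in $X$. (1) If $X$ is a real normed space with $\dim X = 3$, then there are at most $4$ two-dimensional linear subspaces $Y \subset X$ with $\lambda(Y,X) = \frac{4}{3}$. (2) The bound $4$ is attained: for $X = \ell_\infty^3$, that is, $\mathbb{R}^3$ with the norm $\max_i |x_i|$, there are exactly $4$ two-dimensional linear subspaces $Y \subset X$ with $\lambda(Y,X) = \frac{4}{3}$. -/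

import Mathlib

/-- The set `𝒫(X, Y)` of all projections of the real normed space `X` onto its subspace `Y`:
the bounded linear operators `P : X → Y` whose restriction to `Y` is the identity. -/
def projectionsOnto {X : Type*} [NormedAddCommGroup X] [NormedSpace ℝ X]
    (Y : Submodule ℝ X) : Set (X →L[ℝ] Y) :=
  {P | ∀ y : Y, P (y : X) = y}

/-- The relative projection constant `λ(Y, X) = inf {‖P‖ : P ∈ 𝒫(X, Y)}`, with `‖P‖` the operator
norm. When `X` is finite-dimensional the set of projections is nonempty, see
`projectionsOnto_nonempty`, so this is a genuine infimum of a nonempty set of nonnegative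
reals. -/
noncomputable def relProjConst {X : Type*} [NormedAddCommGroup X] [NormedSpace ℝ X]
    (Y : Submodule ℝ X) : ℝ :=
  sInf ((fun P : X →L[ℝ] Y => ‖P‖) '' projectionsOnto Y)

theorem projectionsOnto_nonempty {X : Type*} [NormedAddCommGroup X] [NormedSpace ℝ X]
    [FiniteDimensional ℝ X] (Y : Submodule ℝ X) : (projectionsOnto Y).Nonempty := by
  obtain ⟨f, hf⟩ := Y.subtype.exists_leftInverse_of_injective Y.ker_subtype
  exact ⟨LinearMap.toContinuousLinearMap f, fun y => LinearMap.congr_fun hf y⟩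

open Module

/-! Let N = J − 2I be the 3×3 array with −1 on and 1 off the diagonal, J being all ones. Duality at
a minimal projection onto Y, with the equality case of Bohnenblust's bound 4/3, yields points x_j
and functionals h_i in the unit balls with (h_i(x_j)) = N and Y = ker ∑ h_i
(`exists_isExtremalSystem`). For a second such plane Y', with system (x', h'), the arrays D =
(h'_i(x_j)) and A = (h_i(x'_j)) have entries in [-1, 1] and satisfy D N⁻¹ A = N. Since det N = 4 is
the largest determinant of such an array, |det D| = 4 as well, and a finite analysis
(`isAdmissiblePattern_of_sum_eq`) leaves two cases: Y' = Y, or Y' belongs to one of three indices k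
and is determined by how far the unit ball extends from x_k in the direction of the sum of the other
two points (`IsExtremalSystem.IsEdgePlane.unique`). Hence at most 1 + 3 planes. In ℓ_∞^3 the planes
orthogonal to sign vectors have constant 4/3, and up to sign there are four such vectors. -/

/-! ### Carathéodory's theorem and compactness of convex hulls. -/

theorem exists_fin_convexCombination {E : Type*} [AddCommGroup E] [Module ℝ E]
    [FiniteDimensional ℝ E] {s : Set E} {x : E} (hx : x ∈ convexHull ℝ s) {n : ℕ}
    (hn : finrank ℝ E + 1 ≤ n) :
    ∃ (z : Fin n → E) (w : Fin n → ℝ), (∀ i, z i ∈ s) ∧ (∀ i, 0 ≤ w i) ∧ ∑ i, w i = 1 ∧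
      ∑ i, w i • z i = x := by
  obtain ⟨s₀, hs₀⟩ : s.Nonempty := convexHull_nonempty_iff.mp ⟨x, hx⟩
  obtain ⟨ι, _, z, w, hz, hind, hw, hw1, hwx⟩ := eq_pos_convex_span_of_mem_convexHull hx
  have hcard : Fintype.card ι ≤ Fintype.card (Fin n) := by
    have h1 := hind.card_le_finrank_succ
    have h2 := Submodule.finrank_le (vectorSpan ℝ (Set.range z))
    simp only [Fintype.card_fin]
    omega
  obtain ⟨e⟩ := Function.Embedding.nonempty_of_card_le hcard
  have he := e.injective
  -- Unused indices get the point `s₀` with weight 0, so that the number of terms is exactly `n`.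
  refine ⟨Function.extend e z fun _ => s₀, Function.extend e w 0, fun i => ?_, fun i => ?_, ?_, ?_⟩
  · by_cases h : ∃ a, e a = i
    · obtain ⟨a, rfl⟩ := h
      rw [he.extend_apply]
      exact hz ⟨a, rfl⟩
    · rwa [Function.extend_apply' _ _ _ h]
  · by_cases h : ∃ a, e a = i
    · obtain ⟨a, rfl⟩ := h
      rw [he.extend_apply]
      exact (hw a).le
    · rw [Function.extend_apply' _ _ _ h]
      rfl
  · rw [← hw1]
    refine (Fintype.sum_of_injective e he _ _ (fun i hi => ?_) fun a => ?_).symm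
    · rw [Function.extend_apply' _ _ _ fun ⟨a, ha⟩ => hi ⟨a, ha⟩]
      rfl
    · rw [he.extend_apply]
  · rw [← hwx]
    refine (Fintype.sum_of_injective e he _ _ (fun i hi => ?_) fun a => ?_).symm
    · rw [Function.extend_apply' (f := e) w _ _ fun ⟨a, ha⟩ => hi ⟨a, ha⟩]
      simp
    · rw [he.extend_apply, he.extend_apply]

theorem IsCompact.convexHull_of_finiteDimensional {E : Type*} [NormedAddCommGroup E]
    [NormedSpace ℝ E] [FiniteDimensional ℝ E] {s : Set E} (hs : IsCompact s) :
    IsCompact (convexHull ℝ s) := by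
  let n := finrank ℝ E + 1
  have key : convexHull ℝ s = (fun p : (Fin n → E) × (Fin n → ℝ) => ∑ i, p.2 i • p.1 i) ''
      ((Set.univ.pi fun _ => s) ×ˢ stdSimplex ℝ (Fin n)) := by
    apply Set.Subset.antisymm
    · intro x hx
      obtain ⟨z, w, hz, hw, hw1, hwx⟩ := exists_fin_convexCombination hx le_rfl
      exact ⟨(z, w), ⟨fun i _ => hz i, hw, hw1⟩, hwx⟩
    · rintro _ ⟨⟨z, w⟩, ⟨hz, hw, hw1⟩, rfl⟩
      exact (convex_convexHull ℝ s).sum_mem (fun i _ => hw i) hw1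
        fun i _ => subset_convexHull ℝ s (hz i trivial)
  rw [key]
  refine ((isCompact_univ_pi fun _ => hs).prod (isCompact_stdSimplex ℝ (Fin n))).image ?_
  fun_prop

/-! ### Minimal projections and their norming pairs. -/

section Projections

variable {X : Type*} [NormedAddCommGroup X] [NormedSpace ℝ X]

theorem relProjConst_le (Y : Submodule ℝ X) {P : X →L[ℝ] Y} (hP : P ∈ projectionsOnto Y) :
    relProjConst Y ≤ ‖P‖ :=
  csInf_le ⟨0, by rintro _ ⟨Q, -, rfl⟩; exact norm_nonneg Q⟩ ⟨P, hP, rfl⟩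

/-- The constant is the distance from 0 to a closed set in a proper space, hence attained. -/
theorem exists_projection_norm_eq_relProjConst [FiniteDimensional ℝ X] (Y : Submodule ℝ X) :
    ∃ P ∈ projectionsOnto Y, ‖P‖ = relProjConst Y := by
  have : ProperSpace (X →L[ℝ] Y) := FiniteDimensional.proper_real (X →L[ℝ] Y)
  have hclosed : IsClosed (projectionsOnto Y) := by
    simp only [projectionsOnto, Set.ofPred_forall]
    exact isClosed_iInter fun y => isClosed_eq (by fun_prop) continuous_const
  obtain ⟨P, hP, hdist⟩ := hclosed.exists_infDist_eq_dist (projectionsOnto_nonempty Y) 0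
  refine ⟨P, hP, le_antisymm ?_ (relProjConst_le Y hP)⟩
  refine le_csInf ((projectionsOnto_nonempty Y).image _) ?_
  rintro _ ⟨Q, hQ, rfl⟩
  have := Metric.infDist_le_dist_of_mem (x := (0 : X →L[ℝ] Y)) hQ
  rw [hdist] at this
  exact (dist_zero_left P).ge.trans (this.trans (dist_zero_left Q).le)

theorem opNorm_le_of_forall_dual {Y : Submodule ℝ X} (Q : X →L[ℝ] Y) {a : ℝ}
    (h : ∀ (x : X) (g : StrongDual ℝ X), ‖x‖ ≤ 1 → ‖g‖ ≤ 1 → g (Q x : X) ≤ a) : ‖Q‖ ≤ a := by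
  have ha : 0 ≤ a := by simpa using h 0 0 (by simp) (by simp)
  refine Q.opNorm_le_of_unit_norm ha fun x hx => ?_
  obtain ⟨g, hg, hgx⟩ := exists_dual_vector'' ℝ (Q x : X)
  have := h x g hx.le hg
  rw [hgx] at this
  exact this

/-- Optimality conditions at a projection of minimal norm onto the plane `ker f`. -/
theorem exists_active_pairs [FiniteDimensional ℝ X] {Y : Submodule ℝ X}
    (hY : finrank ℝ Y = 2) (f : StrongDual ℝ X) (hf : ∀ y ∈ Y, f y = 0) {P : X →L[ℝ] Y}
    (hP : P ∈ projectionsOnto Y) (hPnorm : ‖P‖ = relProjConst Y) (hpos : 0 < ‖P‖) :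
    ∃ (x : Fin 3 → X) (g : Fin 3 → StrongDual ℝ X) (w : Fin 3 → ℝ),
      (∀ i, ‖x i‖ ≤ 1) ∧ (∀ i, ‖g i‖ ≤ 1) ∧ (∀ i, g i (P (x i) : X) = ‖P‖) ∧ (∀ i, 0 ≤ w i) ∧
      ∑ i, w i = 1 ∧ ∀ y ∈ Y, ∑ i, w i * (f (x i) * g i y) = 0 := by
  classical
  have : ProperSpace X := FiniteDimensional.proper_real _
  have : ProperSpace (StrongDual ℝ X) := FiniteDimensional.proper_real _
  let b : Basis (Fin 2) ℝ Y := finBasisOfFinrankEq ℝ Y hY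
  let ξ : X × StrongDual ℝ X → Fin 2 → ℝ := fun p i => f p.1 * p.2 (b i : X)
  let ρ : X × StrongDual ℝ X → ℝ := fun p => p.2 (P p.1 : X)
  let S : Set (X × StrongDual ℝ X) := Metric.closedBall 0 1 ×ˢ Metric.closedBall 0 1
  have hS : IsCompact S := (isCompact_closedBall _ _).prod (isCompact_closedBall _ _)
  have hmem : ∀ p : X × StrongDual ℝ X, p ∈ S ↔ ‖p.1‖ ≤ 1 ∧ ‖p.2‖ ≤ 1 := by
    intro p
    simp [S, Set.mem_prod]
  have hρ : ∀ p ∈ S, ρ p ≤ ‖P‖ := by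
    intro p hp
    obtain ⟨h1, h2⟩ := (hmem p).1 hp
    calc p.2 (P p.1 : X) ≤ ‖p.2 (P p.1 : X)‖ := Real.le_norm_self _
      _ ≤ 1 * ‖(P p.1 : X)‖ := p.2.le_of_opNorm_le h2 _
      _ ≤ 1 * (‖P‖ * 1) := by
          gcongr
          exact P.le_opNorm_of_le h1
      _ = ‖P‖ := by ring
  let K : Set ((Fin 2 → ℝ) × ℝ) := (fun p => (ξ p, ρ p)) '' S
  have hK : IsCompact K := by
    refine hS.image ?_
    dsimp only [ξ, ρ]
    fun_prop
  -- If the hull missed the vertical ray above (0, ‖P‖), a separating functional would give a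
  -- rank-one correction of `P` of smaller norm.
  have hinter : ∃ r, ‖P‖ ≤ r ∧ ((0 : Fin 2 → ℝ), r) ∈ convexHull ℝ K := by
    by_contra! hcon
    let T : Set ((Fin 2 → ℝ) × ℝ) := {0} ×ˢ Set.Ici ‖P‖
    have hdisj : Disjoint (convexHull ℝ K) T := by
      rw [Set.disjoint_left]
      rintro ⟨q, r⟩ h1 ⟨h2, h3⟩
      obtain rfl : q = 0 := h2
      exact hcon r h3 h1
    obtain ⟨φ, u, v, hu, huv, hv⟩ := geometric_hahn_banach_compact_closed
      (convex_convexHull ℝ K) hK.convexHull_of_finiteDimensional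
      ((convex_singleton (0 : Fin 2 → ℝ)).prod (convex_Ici ‖P‖))
      (isClosed_singleton.prod isClosed_Ici) hdisj
    have hφ : ∀ (q : Fin 2 → ℝ) (r : ℝ),
        φ (q, r) = ∑ i, q i * φ (Pi.single i 1, 0) + r * φ (0, 1) := by
      intro q r
      have : (q, r) = ∑ i, q i • ((Pi.single i 1 : Fin 2 → ℝ), (0 : ℝ)) +
          r • ((0 : Fin 2 → ℝ), (1 : ℝ)) := by
        ext i
        · fin_cases i <;> simp [Fin.sum_univ_two]
        · simp
      rw [this]
      simp only [map_add, map_sum, map_smul, smul_eq_mul]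
    set β := φ (0, 1) with hβ
    have hu0 : 0 < u := by
      have := hu (0, 0) (subset_convexHull ℝ K ⟨(0, 0), by simp [hmem], by
        ext i <;> simp [ξ, ρ]⟩)
      rwa [show ((0 : Fin 2 → ℝ), (0 : ℝ)) = 0 from rfl, map_zero] at this
    have hPβ : u < ‖P‖ * β := by
      have := hv (0, ‖P‖) ⟨rfl, Set.mem_Ici.2 le_rfl⟩
      rw [hφ] at this
      simp only [Pi.zero_apply, zero_mul, Finset.sum_const_zero, zero_add] at this
      linarith
    have hβ0 : 0 < β := by
      by_contra! h
      nlinarith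
    -- With this `y`, dividing the separating inequality by β reads g(Qx) ≤ u / β < ‖P‖ on the unit
    -- balls.
    let y : Y := ∑ i, (φ (Pi.single i 1, 0) / β) • b i
    let Q : X →L[ℝ] Y := P + f.smulRight y
    have hQ : Q ∈ projectionsOnto Y := by
      intro z
      simp only [Q, _root_.add_apply, ContinuousLinearMap.smulRight_apply,
        hf z z.2, zero_smul, add_zero]
      exact hP z
    have hQnorm : ‖Q‖ ≤ u / β := by
      refine opNorm_le_of_forall_dual Q fun x g hx hg => ?_
      rw [le_div_iff₀ hβ0]
      have h1 := hu _ (subset_convexHull ℝ K ⟨(x, g), (hmem _).2 ⟨hx, hg⟩, rfl⟩)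
      rw [hφ] at h1
      refine le_trans (le_of_eq ?_) h1.le
      simp only [Q, y, ξ, ρ, Fin.sum_univ_two, _root_.add_apply,
        ContinuousLinearMap.smulRight_apply, Submodule.coe_add, Submodule.coe_smul, map_add,
        map_smul, smul_eq_mul]
      field_simp
      ring
    have := relProjConst_le Y hQ
    rw [← hPnorm] at this
    have h2 : u / β < ‖P‖ := by rwa [div_lt_iff₀ hβ0]
    linarith
  obtain ⟨r, hr, hrK⟩ := hinter
  obtain ⟨ι, _, z, w, hz, -, hw, hw1, hwx⟩ := eq_pos_convex_span_of_mem_convexHull hrK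
  have hz1 : ∑ i, w i • (z i).1 = 0 := by simpa [Prod.fst_sum] using congrArg Prod.fst hwx
  have hz2 : ∑ i, w i * (z i).2 = r := by simpa [Prod.snd_sum] using congrArg Prod.snd hwx
  have hzle : ∀ i, (z i).2 ≤ ‖P‖ := by
    intro i
    obtain ⟨p, hp, hpz⟩ := hz ⟨i, rfl⟩
    rw [← hpz]
    exact hρ p hp
  have hzeq : ∀ i, (z i).2 = ‖P‖ := by
    have hsum : ∑ i, w i * (‖P‖ - (z i).2) = 0 := by
      refine le_antisymm ?_ (Finset.sum_nonneg fun i _ =>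
        mul_nonneg (hw i).le (sub_nonneg.2 (hzle i)))
      simp only [mul_sub, Finset.sum_sub_distrib, ← Finset.sum_mul, hw1, hz2]
      linarith
    intro i
    have := (Finset.sum_eq_zero_iff_of_nonneg fun i _ =>
      mul_nonneg (hw i).le (sub_nonneg.2 (hzle i))).1 hsum i (Finset.mem_univ i)
    have := (mul_eq_zero.1 this).resolve_left (hw i).ne'
    linarith
  -- Only norming pairs occur, so the height can be dropped: Carathéodory in ℝ² then needs three
  -- pairs, not the four of ℝ³.
  have h0 : (0 : Fin 2 → ℝ) ∈ convexHull ℝ (ξ '' {p ∈ S | ρ p = ‖P‖}) := by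
    rw [← hz1]
    refine (convex_convexHull ℝ _).sum_mem (fun i _ => (hw i).le) hw1 fun i _ =>
      subset_convexHull ℝ _ ?_
    obtain ⟨p, hp, hpz⟩ := hz ⟨i, rfl⟩
    refine ⟨p, ⟨hp, ?_⟩, ?_⟩
    · rw [← hzeq i, ← hpz]
    · rw [← hpz]
  obtain ⟨z', w', hz', hw', hw1', hwx'⟩ := exists_fin_convexCombination h0 (n := 3) (by simp)
  choose p hp hpz using hz'
  refine ⟨fun i => (p i).1, fun i => (p i).2, w', fun i => ((hmem _).1 (hp i).1).1,
    fun i => ((hmem _).1 (hp i).1).2, fun i => (hp i).2, hw', hw1', fun y hy => ?_⟩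
  have hb : ∀ k, ∑ i, w' i * (f (p i).1 * (p i).2 (b k : X)) = 0 := by
    intro k
    have := congrFun hwx' k
    simpa [← hpz, ξ] using this
  have hyb := b.sum_repr ⟨y, hy⟩
  have hyb' : y = ∑ k, b.repr ⟨y, hy⟩ k • (b k : X) := by
    calc y = ((∑ k, b.repr ⟨y, hy⟩ k • b k : Y) : X) := by rw [hyb]
      _ = _ := by simp only [Submodule.coe_sum, Submodule.coe_smul]
  rw [hyb']
  simp only [map_sum, map_smul, smul_eq_mul, Finset.mul_sum]
  rw [Finset.sum_comm]
  refine Finset.sum_eq_zero fun k _ => ?_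
  rw [← mul_zero (b.repr ⟨y, hy⟩ k), ← hb k, Finset.mul_sum]
  exact Finset.sum_congr rfl fun i _ => by ring

end Projections

/-! ### The equality case of Bohnenblust's bound. -/

/-- The hypotheses give f_j (1/3 + 2 w_j) ≤ M. Concavity of w / (1/3 + 2w) then bounds M = ∑ w_j f_j
by M itself, so every inequality is an equality. -/
theorem forall_eq_of_bohnenblust_equality {w f : Fin 3 → ℝ} {G : Fin 3 → Fin 3 → ℝ} {C : ℝ}
    (hw : ∀ i, 0 ≤ w i) (hw1 : ∑ i, w i = 1) (hf : ∀ i, 0 ≤ f i) (hG : ∀ i j, |G i j| ≤ 1)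
    (hC : ∀ j, C * f j = ∑ i, w i * f i * G i j) (htr : C = 4 / 3 + ∑ i, w i * G i i)
    (hM : 0 < ∑ i, w i * f i) :
    C = 1 / 3 ∧ (∀ i, w i = 1 / 3) ∧ (∀ i, f i = ∑ k, w k * f k) ∧
      ∀ i j, G i j = if i = j then -1 else 1 := by
  set M := ∑ i, w i * f i with hMdef
  have hG1 : ∀ i j, G i j ≤ 1 := fun i j => (abs_le.1 (hG i j)).2
  have hG2 : ∀ i j, -1 ≤ G i j := fun i j => (abs_le.1 (hG i j)).1
  have hwf : ∀ i, 0 ≤ w i * f i := fun i => mul_nonneg (hw i) (hf i)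
  have h1 : ∀ j, f j * (C + w j * (1 - G j j)) ≤ M := by
    intro j
    have : C * f j ≤ M - w j * f j * (1 - G j j) := by
      rw [hC j, hMdef, ← Finset.add_sum_erase _ _ (Finset.mem_univ j),
        ← Finset.add_sum_erase (a := j) _ (fun i => w i * f i) (Finset.mem_univ j)]
      have : ∑ i ∈ Finset.univ.erase j, w i * f i * G i j ≤
          ∑ i ∈ Finset.univ.erase j, w i * f i :=
        Finset.sum_le_sum fun i _ => mul_le_of_le_one_right (hwf i) (hG1 i j)
      linarith
    linarith
  have h2 : ∀ j, f j * (1 / 3 + 2 * w j) ≤ M := by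
    intro j
    refine le_trans (mul_le_mul_of_nonneg_left ?_ (hf j)) (h1 j)
    have : w j * (1 + G j j) ≤ ∑ i, w i * (1 + G i i) :=
      Finset.single_le_sum (f := fun i => w i * (1 + G i i))
        (fun i _ => mul_nonneg (hw i) (by linarith [hG2 i i])) (Finset.mem_univ j)
    simp only [mul_add, Finset.sum_add_distrib, mul_one, hw1] at this
    linarith
  -- Here 2/9 + w/3 is the tangent line of w / (1/3 + 2w) at w = 1/3.
  let p : Fin 3 → ℝ := fun j => M * (2 / 9 + w j / 3) - w j * f j
  have hp : ∀ j, 2 * M * (w j - 1 / 3) ^ 2 ≤ p j * (1 + 6 * w j) := by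
    intro j
    have := mul_le_mul_of_nonneg_left (h2 j) (hw j)
    simp only [p]
    linarith
  have hp0 : ∀ j, 0 ≤ p j := by
    intro j
    have h3 : 0 ≤ p j * (1 + 6 * w j) := le_trans (by positivity) (hp j)
    exact nonneg_of_mul_nonneg_left h3 (by linarith [hw j])
  have hpsum : ∑ j, p j = 0 := by
    simp only [p, Finset.sum_sub_distrib, ← Finset.mul_sum, Finset.sum_add_distrib,
      ← Finset.sum_div, hw1, ← hMdef]
    simp
    ring
  have hpz : ∀ j, p j = 0 := fun j =>
    (Finset.sum_eq_zero_iff_of_nonneg fun i _ => hp0 i).1 hpsum j (Finset.mem_univ j)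
  have hw3 : ∀ i, w i = 1 / 3 := by
    intro i
    have h3 := hp i
    rw [hpz i, zero_mul] at h3
    have h4 : (w i - 1 / 3) ^ 2 = 0 := le_antisymm
      (nonpos_of_mul_nonpos_right h3 (by positivity)) (sq_nonneg _)
    linarith [pow_eq_zero_iff (two_ne_zero) |>.1 h4]
  have hfM : ∀ i, f i = M := by
    intro i
    have := hpz i
    simp only [p, hw3 i] at this
    linarith
  have h5 : ∀ j, C + 1 / 3 * (1 - G j j) ≤ 1 := by
    intro j
    have := h1 j
    rw [hfM j, hw3 j] at this
    exact le_of_mul_le_mul_left (by linarith) hM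
  have hsum : ∀ j, C = 1 / 3 * ∑ i, G i j := by
    intro j
    have := hC j
    simp only [hfM, hw3, Finset.mul_sum] at this ⊢
    refine mul_right_cancel₀ hM.ne' ?_
    rw [this, Finset.sum_mul]
    exact Finset.sum_congr rfl fun i _ => by ring
  simp only [hw3, Fin.sum_univ_three] at htr hsum
  have hC3 : C = 1 / 3 := by
    linarith [h5 0, h5 1, h5 2, hG2 0 0, hG2 1 1, hG2 2 2]
  refine ⟨hC3, hw3, hfM, fun i j => ?_⟩
  have h00 := hG2 0 0
  have h11 := hG2 1 1
  have h22 := hG2 2 2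
  fin_cases i <;> fin_cases j <;> simp <;>
    linarith [hsum 0, hsum 1, hsum 2, hG1 0 1, hG1 0 2, hG1 1 0, hG1 1 2, hG1 2 0, hG1 2 1]

section Systems

variable {X : Type*} [NormedAddCommGroup X] [NormedSpace ℝ X]

/-- Three points and three functionals in the unit balls of `X` and its dual, with the sign pattern
that characterises planes of projection constant `4 / 3`. -/
structure IsExtremalSystem (x : Fin 3 → X) (h : Fin 3 → X →ₗ[ℝ] ℝ) : Prop where
  norm_le : ∀ i, ‖x i‖ ≤ 1
  abs_le : ∀ i v, |h i v| ≤ ‖v‖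
  apply_eq : ∀ i j, h i (x j) = if i = j then -1 else 1

theorem exists_isExtremalSystem (hX : finrank ℝ X = 3) {Y : Submodule ℝ X}
    (hY : finrank ℝ Y = 2) (hYc : relProjConst Y = 4 / 3) :
    ∃ (x : Fin 3 → X) (h : Fin 3 → X →ₗ[ℝ] ℝ), IsExtremalSystem x h ∧
      Y = LinearMap.ker (∑ i, h i) := by
  have : FiniteDimensional ℝ X := FiniteDimensional.of_finrank_pos (by omega)
  have hlt : Y < ⊤ := lt_top_iff_ne_top.2 fun h => by
    rw [h, finrank_top] at hY
    omega
  obtain ⟨f₀, hf₀, hYf₀⟩ := Y.exists_le_ker_of_lt_top hlt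
  obtain ⟨u₀, hu₀⟩ : ∃ u, f₀ u ≠ 0 := by
    by_contra! h
    exact hf₀ (LinearMap.ext h)
  have hYker : Y = LinearMap.ker f₀ := by
    refine Submodule.eq_of_le_of_finrank_le hYf₀ ?_
    have h1 := f₀.finrank_range_add_finrank_ker
    have h2 : 0 < finrank ℝ (LinearMap.range f₀) := by
      rw [Module.finrank_pos_iff_exists_ne_zero]
      exact ⟨⟨f₀ u₀, u₀, rfl⟩, fun h => hu₀ (congrArg Subtype.val h)⟩
    omega
  let f : StrongDual ℝ X := LinearMap.toContinuousLinearMap f₀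
  have hfY : ∀ v, v ∈ Y ↔ f v = 0 := by
    intro v
    rw [hYker]
    rfl
  let u : X := (f u₀)⁻¹ • u₀
  have hu : f u = 1 := by
    simp only [u, map_smul, smul_eq_mul]
    exact inv_mul_cancel₀ hu₀
  obtain ⟨P, hP, hPn⟩ := exists_projection_norm_eq_relProjConst Y
  obtain ⟨x, g, w, hx, hg, hgP, hw, hw1, hY0⟩ :=
    exists_active_pairs hY f (fun y hy => (hfY y).1 hy) hP hPn (by rw [hPn, hYc]; norm_num)
  rw [hPn, hYc] at hgP
  -- Flipping signs makes f nonnegative at the points `x'`; the extra minus sign in `h` turns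
  -- g_i(x_i) into −h_i(x'_i).
  let s : Fin 3 → ℝ := fun i => if 0 ≤ f (x i) then 1 else -1
  have hs : ∀ i, |s i| = 1 := by
    intro i
    simp only [s]
    split_ifs <;> simp
  have hss : ∀ i, s i * s i = 1 := by
    intro i
    rw [← abs_mul_abs_self, hs, one_mul]
  let x' : Fin 3 → X := fun i => s i • x i
  let h : Fin 3 → X →ₗ[ℝ] ℝ := fun i => (-s i) • (g i : X →ₗ[ℝ] ℝ)
  have hh : ∀ i v, h i v = -s i * g i v := fun i v => rfl
  have hhabs : ∀ i v, |h i v| ≤ ‖v‖ := by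
    intro i v
    rw [hh, abs_mul, abs_neg, hs, one_mul]
    simpa using (g i).le_of_opNorm_le (hg i) v
  have hx' : ∀ i, ‖x' i‖ ≤ 1 := by
    intro i
    simp only [x', norm_smul, Real.norm_eq_abs, hs, one_mul, hx]
  have hfx' : ∀ i, f (x' i) = s i * f (x i) := fun i => by simp [x']
  have hf0 : ∀ i, 0 ≤ f (x' i) := by
    intro i
    rw [hfx']
    simp only [s]
    split_ifs with h0
    · linarith
    · linarith
  have hsub : ∀ v, v - f v • u ∈ Y := by
    intro v
    rw [hfY]
    simp [hu]
  have hYh : ∀ y ∈ Y, ∑ i, w i * f (x' i) * h i y = 0 := by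
    intro y hy
    rw [← neg_eq_zero, ← hY0 y hy, ← Finset.sum_neg_distrib]
    refine Finset.sum_congr rfl fun i _ => ?_
    rw [hfx', hh]
    linear_combination w i * f (x i) * g i y * hss i
  -- The functional ∑ w_i f(x'_i) h_i vanishes on Y = ker f, hence equals C f.
  let C : ℝ := ∑ i, w i * f (x' i) * h i u
  have hCv : ∀ v, C * f v = ∑ i, w i * f (x' i) * h i v := by
    intro v
    have h1 := hYh _ (hsub v)
    simp only [map_sub, map_smul, smul_eq_mul, mul_sub, Finset.sum_sub_distrib] at h1
    rw [sub_eq_zero] at h1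
    rw [h1, Finset.sum_mul]
    exact Finset.sum_congr rfl fun i _ => by ring
  have hPx : ∀ v, (P v : X) = v - f v • (u - P u) := by
    intro v
    have h1 : (P (v - f v • u) : X) = v - f v • u := congrArg Subtype.val (hP ⟨_, hsub v⟩)
    simp only [map_sub, map_smul, Submodule.coe_sub, Submodule.coe_smul] at h1
    rw [smul_sub]
    rw [sub_eq_iff_eq_add.1 h1]
    abel
  -- Average g_i(P x_i) = 4/3 with weights w_i and insert P v = v − f(v)(u − P u); the P u term
  -- drops out because it lies in Y.
  have htr : C = 4 / 3 + ∑ i, w i * h i (x' i) := by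
    have h1 : ∑ i, w i * g i (P (x i) : X) = 4 / 3 := by
      simp only [hgP, ← Finset.sum_mul, hw1, one_mul]
    have h2 := hYh _ (P u).2
    rw [← h1, ← sub_zero C, ← h2, ← Finset.sum_sub_distrib, ← Finset.sum_add_distrib]
    refine Finset.sum_congr rfl fun i _ => ?_
    rw [hPx (x i), hfx', hh, hh, hh]
    simp only [x', map_sub, map_smul, smul_eq_mul]
    linear_combination (-w i * f (x i) * (g i u - g i (P u)) + w i * g i (x i)) * hss i
  have hC0 : 1 / 3 ≤ C := by
    have h1 : ∑ i, w i * (-1) ≤ ∑ i, w i * h i (x' i) := by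
      refine Finset.sum_le_sum fun i _ => mul_le_mul_of_nonneg_left ?_ (hw i)
      exact (abs_le.1 ((hhabs i _).trans (hx' i))).1
    rw [← Finset.sum_mul, hw1] at h1
    linarith
  have hM : 0 < ∑ i, w i * f (x' i) := by
    refine lt_of_le_of_ne (Finset.sum_nonneg fun i _ => mul_nonneg (hw i) (hf0 i)) fun h0 => ?_
    have h1 := (Finset.sum_eq_zero_iff_of_nonneg fun i _ => mul_nonneg (hw i) (hf0 i)).1 h0.symm
    have h2 := hCv u
    rw [Finset.sum_eq_zero fun i hi => by rw [h1 i hi, zero_mul], hu] at h2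
    linarith
  obtain ⟨hC3, hw3, hfM, hN⟩ := forall_eq_of_bohnenblust_equality (f := fun i => f (x' i))
    (G := fun i j => h i (x' j)) hw hw1 hf0 (fun i j => (hhabs i _).trans (hx' j))
    (fun j => hCv (x' j)) htr hM
  refine ⟨x', h, ⟨hx', hhabs, hN⟩, ?_⟩
  ext v
  rw [hfY, LinearMap.mem_ker, LinearMap.sum_apply]
  have h3 : ∀ i, f (x' i) = ∑ k, w k * f (x' k) := hfM
  have h1 : C * f v = ∑ i, 1 / 3 * ((∑ k, w k * f (x' k)) * h i v) := by
    rw [hCv v]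
    exact Finset.sum_congr rfl fun i _ => by rw [hw3, ← h3, mul_assoc]
  have h2 : f v = (∑ k, w k * f (x' k)) * ∑ i, h i v := by
    rw [← Finset.mul_sum, ← Finset.mul_sum, hC3] at h1
    linarith
  rw [h2, mul_eq_zero]
  simp [hM.ne']

end Systems

/-! ### Arrays with entries in [-1, 1] and determinant ±4. -/

section SignPatterns

variable {R : Type*} [CommRing R]

/-- The determinant of a `3 × 3` array. -/
def det₃ (D : Fin 3 → Fin 3 → R) : R :=
  D 0 0 * (D 1 1 * D 2 2 - D 1 2 * D 2 1) - D 0 1 * (D 1 0 * D 2 2 - D 1 2 * D 2 0) +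
    D 0 2 * (D 1 0 * D 2 1 - D 1 1 * D 2 0)

/-- The cofactors of a `3 × 3` array. -/
def cofactor₃ (D : Fin 3 → Fin 3 → R) (i j : Fin 3) : R :=
  D (i + 1) (j + 1) * D (i + 2) (j + 2) - D (i + 1) (j + 2) * D (i + 2) (j + 1)

/-- The entries of `N * adjugate D * N`, where `N` has `-1` on and `1` off the diagonal. -/
def transfer₃ (D : Fin 3 → Fin 3 → R) (i j : Fin 3) : R :=
  (cofactor₃ D 0 0 + cofactor₃ D 0 1 + cofactor₃ D 0 2 + cofactor₃ D 1 0 + cofactor₃ D 1 1 +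
    cofactor₃ D 1 2 + cofactor₃ D 2 0 + cofactor₃ D 2 1 + cofactor₃ D 2 2) -
    2 * (cofactor₃ D 0 i + cofactor₃ D 1 i + cofactor₃ D 2 i) -
    2 * (cofactor₃ D j 0 + cofactor₃ D j 1 + cofactor₃ D j 2) + 4 * cofactor₃ D j i

/-- The array `D` is, up to sign and permutations of rows and columns moving the entry `(c, k)`
to the corner, of the form `(t, 1, 1; -1, 1, -1; -1, -1, 1)`. -/
def IsEdgePattern (D : Fin 3 → Fin 3 → R) (c k : Fin 3) (σ : R) : Prop :=
  (∀ j, j ≠ k → D c j = σ) ∧ (∀ i, i ≠ c → D i k = -σ) ∧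
    (∀ i, i ≠ c → ∀ j, j ≠ k → ∀ j', j' ≠ k → j ≠ j' → D i j + D i j' = 0) ∧
    ∀ j, j ≠ k → ∀ i, i ≠ c → ∀ i', i' ≠ c → i ≠ i' → D i j + D i' j = 0

set_option synthInstance.maxHeartbeats 400000 in
set_option synthInstance.maxSize 4000 in
instance [DecidableEq R] (D : Fin 3 → Fin 3 → R) (c k : Fin 3) (σ : R) :
    Decidable (IsEdgePattern D c k σ) := by
  unfold IsEdgePattern
  infer_instance

/-- The dichotomy for arrays of the values of one extremal system on another. -/
def IsAdmissiblePattern (D : Fin 3 → Fin 3 → R) : Prop :=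
  (∃ σ, (σ = 1 ∨ σ = -1) ∧ ∀ j, D 0 j + D 1 j + D 2 j = σ) ∨
    ∃ c k σ, (σ = 1 ∨ σ = -1) ∧ IsEdgePattern D c k σ

end SignPatterns

/-- The `3 × 3` array of signs encoded by nine Booleans. -/
def signArray (a b c d e f g h i : Bool) : Fin 3 → Fin 3 → ℤ :=
  let s : Bool → ℤ := fun x => cond x 1 (-1)
  ![![s a, s b, s c], ![s d, s e, s f], ![s g, s h, s i]]

/-- Exhaustion of the 512 sign arrays. -/
theorem signArray_pattern : ∀ a b c d e f g h i : Bool,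
    (det₃ (signArray a b c d e f g h i)).natAbs = 4 →
    (∀ k l, (transfer₃ (signArray a b c d e f g h i) k l).natAbs ≤ 4) →
    (∃ σ : Bool, ∀ j, signArray a b c d e f g h i 0 j + signArray a b c d e f g h i 1 j +
      signArray a b c d e f g h i 2 j = cond σ 1 (-1)) ∨
    ∃ (k l : Fin 3) (σ : Bool),
      IsEdgePattern (signArray a b c d e f g h i) k l (cond σ 1 (-1)) := by
  decide +kernel

theorem abs_det₃_le {D : Fin 3 → Fin 3 → ℝ} (hD : ∀ i j, |D i j| ≤ 1) : |det₃ D| ≤ 4 := by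
  have hmul : ∀ i j (m : ℝ), D i j * m ≤ |m| := fun i j m =>
    (le_abs_self _).trans (by rw [abs_mul]; exact mul_le_of_le_one_left (abs_nonneg _) (hD i j))
  have key : ∀ s₀ s₁ s₂ : ℝ, (s₀ = 1 ∨ s₀ = -1) → (s₁ = 1 ∨ s₁ = -1) → (s₂ = 1 ∨ s₂ = -1) →
      s₀ * (D 1 1 * D 2 2 - D 1 2 * D 2 1) + s₁ * (D 1 2 * D 2 0 - D 1 0 * D 2 2) +
        s₂ * (D 1 0 * D 2 1 - D 1 1 * D 2 0) ≤ 4 := by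
    intro s₀ s₁ s₂ h₀ h₁ h₂
    have h3 := hmul 1 0 (s₂ * D 2 1 - s₁ * D 2 2)
    have h4 := hmul 1 1 (s₀ * D 2 2 - s₂ * D 2 0)
    have h5 := hmul 1 2 (s₁ * D 2 0 - s₀ * D 2 1)
    -- Up to sign the three terms are the pairwise differences of the numbers s_j D_2j in [-1, 1],
    -- so they sum to twice the range, at most 4.
    have h6 : |s₂ * D 2 1 - s₁ * D 2 2| + |s₀ * D 2 2 - s₂ * D 2 0| +
        |s₁ * D 2 0 - s₀ * D 2 1| ≤ 4 := by
      have b0 := abs_le.1 (hD 2 0)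
      have b1 := abs_le.1 (hD 2 1)
      have b2 := abs_le.1 (hD 2 2)
      rcases h₀ with rfl | rfl <;> rcases h₁ with rfl | rfl <;> rcases h₂ with rfl | rfl <;>
        rcases abs_cases (_ * D 2 1 - _ * D 2 2) with ⟨h, _⟩ | ⟨h, _⟩ <;> rw [h] <;>
        rcases abs_cases (_ * D 2 2 - _ * D 2 0) with ⟨h, _⟩ | ⟨h, _⟩ <;> rw [h] <;>
        rcases abs_cases (_ * D 2 0 - _ * D 2 1) with ⟨h, _⟩ | ⟨h, _⟩ <;> rw [h] <;>
        linarith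
    linarith
  have hsign : ∀ m : ℝ, ∃ s : ℝ, (s = 1 ∨ s = -1) ∧ |m| = s * m := by
    intro m
    rcases abs_choice m with h | h
    · exact ⟨1, Or.inl rfl, by linarith⟩
    · exact ⟨-1, Or.inr rfl, by linarith⟩
  obtain ⟨s₀, hs₀, e₀⟩ := hsign (D 1 1 * D 2 2 - D 1 2 * D 2 1)
  obtain ⟨s₁, hs₁, e₁⟩ := hsign (D 1 2 * D 2 0 - D 1 0 * D 2 2)
  obtain ⟨s₂, hs₂, e₂⟩ := hsign (D 1 0 * D 2 1 - D 1 1 * D 2 0)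
  have hk := key s₀ s₁ s₂ hs₀ hs₁ hs₂
  have hb : ∀ j (m : ℝ), |D 0 j * m| ≤ |m| := fun j m => by
    rw [abs_mul]
    exact mul_le_of_le_one_left (abs_nonneg _) (hD 0 j)
  have h0 := abs_le.1 (hb 0 (D 1 1 * D 2 2 - D 1 2 * D 2 1))
  have h1 := abs_le.1 (hb 1 (D 1 2 * D 2 0 - D 1 0 * D 2 2))
  have h2 := abs_le.1 (hb 2 (D 1 0 * D 2 1 - D 1 1 * D 2 0))
  rw [det₃, abs_le]
  constructor <;> linarith

theorem isAdmissiblePattern_of_forall_eq {D : Fin 3 → Fin 3 → ℝ}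
    (hD : ∀ i j, D i j = 1 ∨ D i j = -1) (hdet : |det₃ D| = 4)
    (hT : ∀ i j, |transfer₃ D i j| ≤ 4) : IsAdmissiblePattern D := by
  have hb : ∀ i j, ∃ b : Bool, D i j = ((cond b 1 (-1) : ℤ) : ℝ) := by
    intro i j
    rcases hD i j with h | h
    · exact ⟨true, by simp [h]⟩
    · exact ⟨false, by simp [h]⟩
  choose b hb using hb
  let Z : Fin 3 → Fin 3 → ℤ := signArray (b 0 0) (b 0 1) (b 0 2) (b 1 0) (b 1 1) (b 1 2) (b 2 0)
    (b 2 1) (b 2 2)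
  have hZ : ∀ i j, D i j = (Z i j : ℝ) := by
    intro i j
    rw [hb]
    fin_cases i <;> fin_cases j <;> rfl
  have hdetZ : det₃ D = ((det₃ Z : ℤ) : ℝ) := by
    simp only [det₃, hZ]
    push_cast
    rfl
  have hTZ : ∀ i j, transfer₃ D i j = ((transfer₃ Z i j : ℤ) : ℝ) := by
    intro i j
    simp only [transfer₃, cofactor₃, hZ]
    push_cast
    rfl
  have h1 : (det₃ Z).natAbs = 4 := by
    rw [hdetZ, ← Int.cast_abs] at hdet
    have : |det₃ Z| = 4 := by exact_mod_cast hdet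
    rw [Int.abs_eq_natAbs] at this
    omega
  have h2 : ∀ i j, (transfer₃ Z i j).natAbs ≤ 4 := by
    intro i j
    have := hT i j
    rw [hTZ, ← Int.cast_abs] at this
    have : |transfer₃ Z i j| ≤ 4 := by exact_mod_cast this
    rw [Int.abs_eq_natAbs] at this
    omega
  have hc : ∀ σ : Bool, (((cond σ 1 (-1) : ℤ) : ℝ) = 1 ∨ ((cond σ 1 (-1) : ℤ) : ℝ) = -1) := by
    intro σ
    cases σ <;> simp
  rcases signArray_pattern _ _ _ _ _ _ _ _ _ h1 h2 with ⟨σ, h⟩ | ⟨c, k, σ, h3, h4, h5, h6⟩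
  · refine Or.inl ⟨_, hc σ, fun j => ?_⟩
    simp only [hZ]
    exact_mod_cast h j
  · refine Or.inr ⟨c, k, _, hc σ, fun j hj => ?_, fun i hi => ?_,
      fun i hi j hj j' hj' hjj => ?_, fun j hj i hi i' hi' hii => ?_⟩
    · rw [hZ]
      exact_mod_cast h3 j hj
    · rw [hZ]
      exact_mod_cast h4 i hi
    · rw [hZ, hZ]
      exact_mod_cast h5 i hi j hj j' hj' hjj
    · rw [hZ, hZ]
      exact_mod_cast h6 j hj i hi i' hi' hii

theorem abs_eq_one_of_abs_mul_eq_one {x y z : ℝ} (hx : |x| ≤ 1) (hy : |y| ≤ 1) (hz : |z| ≤ 1)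
    (h : |x * y * z| = 1) : |x| = 1 ∧ |y| = 1 ∧ |z| = 1 := by
  rw [abs_mul, abs_mul] at h
  have hxy : |x| * |y| ≤ 1 := mul_le_one₀ hx (abs_nonneg y) hy
  have h1 : |x| * |y| * |z| ≤ |x| * |y| := mul_le_of_le_one_right (by positivity) hz
  have h2 : |x| * |y| * |z| ≤ |z| := mul_le_of_le_one_left (abs_nonneg z) hxy
  have h3 : |x| * |y| ≤ |x| := mul_le_of_le_one_right (abs_nonneg x) hy
  have h4 : |x| * |y| ≤ |y| := mul_le_of_le_one_left (abs_nonneg y) hx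
  exact ⟨by linarith, by linarith, by linarith⟩

/-- The determinant is affine in the corner entry and extremal at an interior value, so the corner
cofactor vanishes. The four remaining products must then all be ±1, and the bounds on `transfer₃`
fix the signs. -/
theorem isEdgePattern_of_abs_lt_one {D : Fin 3 → Fin 3 → ℝ} (hD : ∀ i j, |D i j| ≤ 1)
    (h00 : |D 0 0| < 1) (hdet : |det₃ D| = 4) (hT : ∀ i j, |transfer₃ D i j| ≤ 4) :
    ∃ σ : ℝ, (σ = 1 ∨ σ = -1) ∧ IsEdgePattern D 0 0 σ := by
  obtain ⟨ht1, ht2⟩ := abs_lt.1 h00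
  set m := D 1 1 * D 2 2 - D 1 2 * D 2 1 with hm
  have hend : ∀ t : ℝ, |t| ≤ 1 → |(t - D 0 0) * m + det₃ D| ≤ 4 := by
    intro t ht
    convert abs_det₃_le (D := Function.update D 0 (Function.update (D 0) 0 t)) ?_ using 2
    · simp only [det₃, hm, Function.update_self, Function.update_of_ne, ne_eq, one_ne_zero,
        not_false_eq_true, Fin.reduceEq]
      ring
    · intro i j
      rcases eq_or_ne i 0 with rfl | hi
      · rcases eq_or_ne j 0 with rfl | hj
        · simpa using ht
        · simpa [hj] using hD 0 j
      · simpa [hi] using hD i j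
  have e1 := abs_le.1 (hend 1 (by simp))
  have e2 := abs_le.1 (hend (-1) (by simp))
  obtain ⟨s, hs, hdets⟩ : ∃ s : ℝ, (s = 1 ∨ s = -1) ∧ det₃ D = 4 * s := by
    rcases abs_choice (det₃ D) with h | h
    · exact ⟨1, Or.inl rfl, by linarith⟩
    · exact ⟨-1, Or.inr rfl, by linarith⟩
  have hm0 : m = 0 := by
    rcases hs with rfl | rfl
    · exact le_antisymm (nonpos_of_mul_nonpos_right (a := 1 - D 0 0) (by linarith) (by linarith))
        (nonneg_of_mul_nonneg_right (a := 1 + D 0 0) (by linarith) (by linarith))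
    · exact le_antisymm (nonpos_of_mul_nonpos_right (a := 1 + D 0 0) (by linarith) (by linarith))
        (nonneg_of_mul_nonneg_right (a := 1 - D 0 0) (by linarith) (by linarith))
  have hprod : ∀ i j k l u v, |D i j * D k l * D u v| ≤ 1 := by
    intro i j k l u v
    rw [abs_mul, abs_mul]
    exact mul_le_one₀ (mul_le_one₀ (hD _ _) (abs_nonneg _) (hD _ _)) (abs_nonneg _) (hD _ _)
  have p1 := abs_le.1 (hprod 0 1 1 0 2 2)
  have p2 := abs_le.1 (hprod 0 1 1 2 2 0)
  have p3 := abs_le.1 (hprod 0 2 1 0 2 1)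
  have p4 := abs_le.1 (hprod 0 2 1 1 2 0)
  have hR : -(D 0 1 * D 1 0 * D 2 2) + D 0 1 * D 1 2 * D 2 0 + D 0 2 * D 1 0 * D 2 1 -
      D 0 2 * D 1 1 * D 2 0 = 4 * s := by
    rw [← hdets, det₃, ← hm, hm0]
    ring
  have hsabs : |s| = 1 := by rcases hs with rfl | rfl <;> simp
  have q1 : D 0 1 * D 1 0 * D 2 2 = -s := by rcases hs with rfl | rfl <;> linarith
  have q2 : D 0 1 * D 1 2 * D 2 0 = s := by rcases hs with rfl | rfl <;> linarith
  have q3 : D 0 2 * D 1 0 * D 2 1 = s := by rcases hs with rfl | rfl <;> linarith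
  have q4 : D 0 2 * D 1 1 * D 2 0 = -s := by rcases hs with rfl | rfl <;> linarith
  obtain ⟨a01, a10, -⟩ := abs_eq_one_of_abs_mul_eq_one (hD 0 1) (hD 1 0) (hD 2 2)
    (by rw [q1, abs_neg, hsabs])
  obtain ⟨a02, -, a20⟩ := abs_eq_one_of_abs_mul_eq_one (hD 0 2) (hD 1 1) (hD 2 0)
    (by rw [q4, abs_neg, hsabs])
  rw [abs_eq zero_le_one] at a01 a10 a02 a20
  have hsq : ∀ {y : ℝ}, (y = 1 ∨ y = -1) → y * y = 1 := by
    rintro y (rfl | rfl) <;> norm_num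
  -- The inner 2×2 block is now expressed by the signs in the first row and column.
  have r22 : D 2 2 = -s * D 0 1 * D 1 0 := by
    linear_combination D 0 1 * D 1 0 * q1 - D 2 2 * D 0 1 ^ 2 * hsq a10 - D 2 2 * hsq a01
  have r12 : D 1 2 = s * D 0 1 * D 2 0 := by
    linear_combination D 0 1 * D 2 0 * q2 - D 1 2 * D 0 1 ^ 2 * hsq a20 - D 1 2 * hsq a01
  have r21 : D 2 1 = s * D 0 2 * D 1 0 := by
    linear_combination D 0 2 * D 1 0 * q3 - D 2 1 * D 0 2 ^ 2 * hsq a10 - D 2 1 * hsq a02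
  have r11 : D 1 1 = -s * D 0 2 * D 2 0 := by
    linear_combination D 0 2 * D 2 0 * q4 - D 1 1 * D 0 2 ^ 2 * hsq a20 - D 1 1 * hsq a02
  have hpat : D 0 2 = D 0 1 ∧ D 1 0 = -D 0 1 ∧ D 2 0 = -D 0 1 := by
    have t00 := abs_le.1 (hT 0 0)
    have t01 := abs_le.1 (hT 0 1)
    have t02 := abs_le.1 (hT 0 2)
    have t10 := abs_le.1 (hT 1 0)
    have t11 := abs_le.1 (hT 1 1)
    have t12 := abs_le.1 (hT 1 2)
    have t20 := abs_le.1 (hT 2 0)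
    have t21 := abs_le.1 (hT 2 1)
    have t22 := abs_le.1 (hT 2 2)
    simp only [transfer₃, cofactor₃, Fin.isValue, Fin.reduceAdd, zero_add, r22, r12, r21, r11]
      at t00 t01 t02 t10 t11 t12 t20 t21 t22
    clear hend e1 e2 hm hm0 hprod p1 p2 p3 p4 hR q1 q2 q3 q4 r22 r12 r21 r11 hdets hdet
    generalize D 0 0 = t at *
    generalize D 0 1 = a at *
    generalize D 0 2 = b at *
    generalize D 1 0 = p at *
    generalize D 2 0 = u at *
    clear hT hD
    rcases a01 with rfl | rfl <;> rcases a02 with rfl | rfl <;> rcases a10 with rfl | rfl <;>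
      rcases a20 with rfl | rfl <;> rcases hs with rfl | rfl <;>
      first
        | (norm_num; done)
        | (exfalso; linarith)
  obtain ⟨hb, hp, hu⟩ := hpat
  rw [hb, hu] at r11
  rw [hu] at r12
  rw [hb, hp] at r21
  rw [hp] at r22
  have ha := hsq a01
  have r11' : D 1 1 = s := by linear_combination r11 + s * ha
  have r12' : D 1 2 = -s := by linear_combination r12 - s * ha
  have r21' : D 2 1 = -s := by linear_combination r21 - s * ha
  have r22' : D 2 2 = s := by linear_combination r22 + s * ha
  refine ⟨D 0 1, a01, ?_, ?_, ?_, ?_⟩ <;>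
    simp [Fin.forall_fin_succ, hb, hp, hu, r11', r12', r21', r22']

theorem IsEdgePattern.of_reindex {R : Type*} [CommRing R] {D : Fin 3 → Fin 3 → R} {c k : Fin 3}
    {σ : R} (e₁ e₂ : Equiv.Perm (Fin 3))
    (h : IsEdgePattern (fun i j => D (e₁ i) (e₂ j)) c k σ) :
    IsEdgePattern D (e₁ c) (e₂ k) σ := by
  obtain ⟨h1, h2, h3, h4⟩ := h
  have n₁ : ∀ {i}, i ≠ e₁ c → e₁.symm i ≠ c := fun hi h => hi ((Equiv.symm_apply_eq _).1 h)
  have n₂ : ∀ {i}, i ≠ e₂ k → e₂.symm i ≠ k := fun hi h => hi ((Equiv.symm_apply_eq _).1 h)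
  refine ⟨fun j hj => ?_, fun i hi => ?_, fun i hi j hj j' hj' hjj => ?_,
    fun j hj i hi i' hi' hii => ?_⟩
  · simpa using h1 _ (n₂ hj)
  · simpa using h2 _ (n₁ hi)
  · simpa using h3 _ (n₁ hi) _ (n₂ hj) _ (n₂ hj') (e₂.symm.injective.ne hjj)
  · simpa using h4 _ (n₂ hj) _ (n₁ hi) _ (n₁ hi') (e₁.symm.injective.ne hii)

/-- Here `H` says D (J − I) A = 2N. Determinants give det D · det A = 16 with both factors at most 4
in modulus, and solving for A gives N adj(D) N = det D · A. -/
theorem abs_det₃_eq_and_abs_transfer₃_le {D A : Fin 3 → Fin 3 → ℝ} (hD : ∀ i j, |D i j| ≤ 1)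
    (hA : ∀ i j, |A i j| ≤ 1)
    (H : ∀ i j, ∑ k, D i k * (∑ l, A l j - A k j) = 2 * (if i = j then -1 else 1)) :
    |det₃ D| = 4 ∧ ∀ i j, |transfer₃ D i j| ≤ 4 := by
  have hprod : det₃ D * det₃ A = 16 := by
    have h1 : det₃ (fun i j => ∑ k, D i k * (∑ l, A l j - A k j)) = 2 * (det₃ D * det₃ A) := by
      simp only [det₃, Fin.sum_univ_three]
      ring
    simp only [H] at h1
    have h2 : det₃ (fun i j : Fin 3 => (2 : ℝ) * (if i = j then -1 else 1)) = 32 := by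
      simp [det₃]
      norm_num
    linarith
  have hDle := abs_det₃_le hD
  have hAle := abs_det₃_le hA
  have hdet : |det₃ D| = 4 := by
    have h1 := congrArg abs hprod
    rw [abs_mul, abs_of_pos (by norm_num : (0 : ℝ) < 16)] at h1
    nlinarith [abs_nonneg (det₃ D)]
  refine ⟨hdet, fun i j => ?_⟩
  have htr : transfer₃ D i j = det₃ D * A i j := by
    -- Row `i` of N adj(D).
    let r : Fin 3 → ℝ := fun l =>
      cofactor₃ D l 0 + cofactor₃ D l 1 + cofactor₃ D l 2 - 2 * cofactor₃ D l i
    have h1 : 2 * transfer₃ D i j = ∑ l, r l * (2 * (if l = j then -1 else 1)) := by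
      fin_cases j <;> simp [Fin.sum_univ_three, transfer₃, r] <;> ring
    simp only [← H] at h1
    have h2 : ∑ l, r l * ∑ k, D l k * (∑ m, A m j - A k j) = 2 * (det₃ D * A i j) := by
      fin_cases i <;> simp [Fin.sum_univ_three, r, cofactor₃, det₃] <;> ring
    linarith
  rw [htr, abs_mul, hdet]
  linarith [hA i j]

theorem isAdmissiblePattern_of_sum_eq {D A : Fin 3 → Fin 3 → ℝ} (hD : ∀ i j, |D i j| ≤ 1)
    (hA : ∀ i j, |A i j| ≤ 1)
    (H : ∀ i j, ∑ k, D i k * (∑ l, A l j - A k j) = 2 * (if i = j then -1 else 1)) :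
    IsAdmissiblePattern D := by
  by_cases hall : ∀ i j, D i j = 1 ∨ D i j = -1
  · obtain ⟨h1, h2⟩ := abs_det₃_eq_and_abs_transfer₃_le hD hA H
    exact isAdmissiblePattern_of_forall_eq hall h1 h2
  · push Not at hall
    obtain ⟨c, k, hck⟩ := hall
    let e₁ : Equiv.Perm (Fin 3) := Equiv.swap 0 c
    let e₂ : Equiv.Perm (Fin 3) := Equiv.swap 0 k
    obtain ⟨h1, h2⟩ := abs_det₃_eq_and_abs_transfer₃_le (D := fun i j => D (e₁ i) (e₂ j))
      (A := fun i j => A (e₂ i) (e₁ j)) (fun i j => hD _ _) (fun i j => hA _ _) fun i j => by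
        simp only [Equiv.sum_comp e₂ fun l => A l (e₁ j)]
        rw [Equiv.sum_comp e₂ fun k => D (e₁ i) k * (∑ l, A l (e₁ j) - A k (e₁ j)), H]
        simp only [e₁.injective.eq_iff]
    have hlt : |D (e₁ 0) (e₂ 0)| < 1 := by
      simp only [e₁, e₂, Equiv.swap_apply_left]
      refine lt_of_le_of_ne (hD c k) fun h => ?_
      rcases (abs_eq zero_le_one).1 h with h | h
      · exact hck.1 h
      · exact hck.2 h
    obtain ⟨σ, hσ, hpat⟩ := isEdgePattern_of_abs_lt_one (D := fun i j => D (e₁ i) (e₂ j))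
      (fun i j => hD _ _) hlt h1 h2
    exact Or.inr ⟨_, _, σ, hσ, hpat.of_reindex⟩

theorem exists_sum_eq_add_add (k : Fin 3) : ∃ a b : Fin 3, a ≠ k ∧ b ≠ k ∧ a ≠ b ∧
    (∀ j, j ≠ k → j = a ∨ j = b) ∧ ∀ F : Fin 3 → ℝ, ∑ j, F j = F k + F a + F b := by
  fin_cases k
  · exact ⟨1, 2, by decide, by decide, by decide, by decide, fun F => Fin.sum_univ_three F⟩
  · refine ⟨0, 2, by decide, by decide, by decide, by decide, fun F => ?_⟩
    rw [Fin.sum_univ_three]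
    simp
    ring
  · refine ⟨0, 1, by decide, by decide, by decide, by decide, fun F => ?_⟩
    rw [Fin.sum_univ_three]
    simp
    ring

/-! ### Comparison of two extremal systems. -/

namespace IsExtremalSystem

variable {X : Type*} [NormedAddCommGroup X] [NormedSpace ℝ X] {x : Fin 3 → X}
  {h : Fin 3 → X →ₗ[ℝ] ℝ}

theorem apply_sum (hs : IsExtremalSystem x h) (c : Fin 3 → ℝ) (i : Fin 3) :
    h i (∑ k, c k • x k) = ∑ k, c k - 2 * c i := by
  simp only [map_sum, map_smul, smul_eq_mul, hs.apply_eq]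
  fin_cases i <;> simp [Fin.sum_univ_three] <;> ring

theorem sum_apply (hs : IsExtremalSystem x h) (j : Fin 3) : (∑ i, h i) (x j) = 1 := by
  simp only [LinearMap.sum_apply, hs.apply_eq]
  fin_cases j <;> simp [Fin.sum_univ_three]

theorem eq_of_forall_apply_eq (hs : IsExtremalSystem x h) (hX : finrank ℝ X = 3) {u v : X}
    (huv : ∀ i, h i u = h i v) : u = v := by
  have : FiniteDimensional ℝ X := FiniteDimensional.of_finrank_pos (by omega)
  have hsurj : Function.Surjective (LinearMap.pi h) := by
    intro y
    -- The coefficients come from N⁻¹ = (J − I) / 2.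
    refine ⟨∑ k, (1 / 2 * (∑ l, y l - y k)) • x k, funext fun i => ?_⟩
    rw [LinearMap.pi_apply, hs.apply_sum]
    simp only [Fin.sum_univ_three]
    ring
  exact (LinearMap.injective_iff_surjective_of_finrank_eq_finrank (by simp [hX])).2 hsurj
    (funext huv)

theorem sum_smul_eq (hs : IsExtremalSystem x h) (hX : finrank ℝ X = 3) (v : X) :
    ∑ k, (1 / 2 * (∑ l, h l v - h k v)) • x k = v := by
  refine hs.eq_of_forall_apply_eq hX fun i => ?_
  rw [hs.apply_sum]
  simp only [Fin.sum_univ_three]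
  ring

theorem linearMap_ext (hs : IsExtremalSystem x h) (hX : finrank ℝ X = 3) {f g : X →ₗ[ℝ] ℝ}
    (hfg : ∀ j, f (x j) = g (x j)) : f = g := by
  ext v
  rw [← hs.sum_smul_eq hX v]
  simp only [map_sum, map_smul, hfg]

theorem isAdmissiblePattern (hs : IsExtremalSystem x h) (hX : finrank ℝ X = 3) {x' : Fin 3 → X}
    {h' : Fin 3 → X →ₗ[ℝ] ℝ} (hs' : IsExtremalSystem x' h') :
    IsAdmissiblePattern fun i j => h' i (x j) := by
  refine isAdmissiblePattern_of_sum_eq (A := fun i j => h i (x' j))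
    (fun i j => (hs'.abs_le i _).trans (hs.norm_le j))
    (fun i j => (hs.abs_le i _).trans (hs'.norm_le j)) fun i j => ?_
  have key : h' i (x' j) =
      ∑ k, 1 / 2 * (∑ l, h l (x' j) - h k (x' j)) * h' i (x k) := by
    conv_lhs => rw [← hs.sum_smul_eq hX (x' j)]
    simp only [map_sum, map_smul, smul_eq_mul]
  rw [← hs'.apply_eq, key, Finset.mul_sum]
  exact Finset.sum_congr rfl fun k _ => by ring

/-- `Y` is the plane attached to the edge of the body spanned by `x` that leaves `x k` in the
direction of the sum of the two other points. -/
def IsEdgePlane (x : Fin 3 → X) (k : Fin 3) (Y : Submodule ℝ X) : Prop :=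
  ∃ (s : ℝ) (f g : X →ₗ[ℝ] ℝ), Y = LinearMap.ker f ∧ (∀ j, j ≠ k → f (x j) = 1) ∧
    f (x k) = -(1 + 2 * s) ∧ ‖x k + s • (∑ j, x j - x k)‖ ≤ 1 ∧ (∀ v, |g v| ≤ ‖v‖) ∧
    (∀ j, j ≠ k → g (x j) = 1) ∧ g (x k) = 1 - 2 * s

/-- The functional `g` certifies that s is the largest parameter keeping x_k + s(∑ x_j − x_k) in the
unit ball. Thus s depends only on the norm, x and k, and it fixes `f` on the spanning points. -/
theorem IsEdgePlane.unique (hs : IsExtremalSystem x h) (hX : finrank ℝ X = 3) {k : Fin 3}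
    {Y Y' : Submodule ℝ X} (hY : IsEdgePlane x k Y) (hY' : IsEdgePlane x k Y') : Y = Y' := by
  have key : ∀ {s t : ℝ} {g : X →ₗ[ℝ] ℝ}, ‖x k + s • (∑ j, x j - x k)‖ ≤ 1 →
      (∀ v, |g v| ≤ ‖v‖) → (∀ j, j ≠ k → g (x j) = 1) → g (x k) = 1 - 2 * t → s ≤ t := by
    intro s t g hn hg h1 h2
    have h3 := (le_abs_self _).trans ((hg _).trans hn)
    obtain ⟨a, b, ha, hb, -, -, hsum⟩ := exists_sum_eq_add_add k
    rw [map_add, map_smul, map_sub, map_sum, hsum fun j => g (x j), h1 a ha, h1 b hb, h2,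
      smul_eq_mul] at h3
    linarith
  obtain ⟨s, f, g, rfl, f1, f2, hn, hg, g1, g2⟩ := hY
  obtain ⟨s', f', g', rfl, f1', f2', hn', hg', g1', g2'⟩ := hY'
  have hss : s = s' := le_antisymm (key hn hg' g1' g2') (key hn' hg g1 g2)
  congr 1
  refine hs.linearMap_ext hX fun j => ?_
  rcases eq_or_ne j k with rfl | hj
  · rw [f2, f2', hss]
  · rw [f1 j hj, f1' j hj]

theorem ker_eq_or_exists_isEdgePlane (hs : IsExtremalSystem x h) (hX : finrank ℝ X = 3)
    {x' : Fin 3 → X} {h' : Fin 3 → X →ₗ[ℝ] ℝ} (hs' : IsExtremalSystem x' h') :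
    LinearMap.ker (∑ i, h' i) = LinearMap.ker (∑ i, h i) ∨
      ∃ k, IsEdgePlane x k (LinearMap.ker (∑ i, h' i)) := by
  have hker : ∀ {σ : ℝ}, (σ = 1 ∨ σ = -1) → ∀ f : X →ₗ[ℝ] ℝ,
      LinearMap.ker (σ • f) = LinearMap.ker f := by
    intro σ hσ f
    exact LinearMap.ker_smul f σ (by rcases hσ with rfl | rfl <;> norm_num)
  rcases hs.isAdmissiblePattern hX hs' with ⟨σ, hσ, hsum⟩ | ⟨c, k, σ, hσ, h1, h2, h3, h4⟩
  · left
    rw [← hker hσ (∑ i, h i)]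
    congr 1
    refine hs.linearMap_ext hX fun j => ?_
    rw [LinearMap.smul_apply, hs.sum_apply, LinearMap.sum_apply, Fin.sum_univ_three, hsum]
    simp
  · right
    beta_reduce at h1 h2 h3 h4
    have hσσ : σ * σ = 1 := by rcases hσ with rfl | rfl <;> norm_num
    obtain ⟨a, b, ha, hb, hab, -, hk⟩ := exists_sum_eq_add_add k
    obtain ⟨p, q, hp, hq, hpq, -, hc⟩ := exists_sum_eq_add_add c
    -- This s makes x_k + s(∑ x_j − x_k) equal to −σ x'_c, a point of the unit ball where σ h'_c
    -- takes the value 1.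
    set s : ℝ := (1 - σ * h' c (x k)) / 2 with hsdef
    refine ⟨k, s, σ • ∑ i, h' i, σ • h' c, (hker hσ _).symm, fun j hj => ?_, ?_, ?_, fun v => ?_,
      fun j hj => ?_, ?_⟩
    · rw [LinearMap.smul_apply, LinearMap.sum_apply, hc fun i => h' i (x j), h1 j hj, add_assoc,
        h4 j hj p hp q hq hpq, add_zero, smul_eq_mul, hσσ]
    · rw [LinearMap.smul_apply, LinearMap.sum_apply, hc fun i => h' i (x k), h2 p hp, h2 q hq,
        smul_eq_mul, hsdef]
      linear_combination -2 * hσσ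
    · have hx' : x k + s • (∑ j, x j - x k) = (-σ) • x' c := by
        refine hs'.eq_of_forall_apply_eq hX fun i => ?_
        rw [map_add, map_smul, map_sub, map_sum, map_smul, hs'.apply_eq,
          hk fun j => h' i (x j), smul_eq_mul, smul_eq_mul]
        rcases eq_or_ne i c with rfl | hi
        · rw [h1 a ha, h1 b hb, if_pos rfl, hsdef]
          linear_combination -h' i (x k) * hσσ
        · rw [if_neg hi, add_assoc, h3 i hi a ha b hb hab, h2 i hi]
          ring
      rw [hx', norm_smul, Real.norm_eq_abs, abs_neg]
      rcases hσ with rfl | rfl <;> simpa using hs'.norm_le c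
    · rw [LinearMap.smul_apply, smul_eq_mul, abs_mul]
      rcases hσ with rfl | rfl <;> simpa using hs'.abs_le c v
    · rw [LinearMap.smul_apply, h1 j hj, smul_eq_mul, hσσ]
    · rw [LinearMap.smul_apply, smul_eq_mul, hsdef]
      ring

/-- Since x_j − x_0 lies in Y, the vectors P x_j and x_j differ by the same vector for all j. Hence
∑ h_j(P x_j) = −3 − 1 = −4, and some term is at most −4/3. -/
theorem four_thirds_le_norm (hs : IsExtremalSystem x h) {Y : Submodule ℝ X}
    (hY : Y = LinearMap.ker (∑ i, h i)) {P : X →L[ℝ] Y} (hP : P ∈ projectionsOnto Y) :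
    4 / 3 ≤ ‖P‖ := by
  have hb : ∀ j, -h j (P (x j) : X) ≤ ‖P‖ := fun j => by
    refine (neg_le_abs _).trans ((hs.abs_le j _).trans ?_)
    simpa using P.le_opNorm_of_le (hs.norm_le j)
  have hd : ∀ j, (P (x j) : X) = P (x 0) + x j - x 0 := by
    intro j
    have hmem : x j - x 0 ∈ Y := by
      rw [hY, LinearMap.mem_ker, map_sub, hs.sum_apply, hs.sum_apply, sub_self]
    have h1 : (P (x j - x 0) : X) = x j - x 0 := congrArg Subtype.val (hP ⟨_, hmem⟩)
    rw [map_sub, Submodule.coe_sub] at h1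
    rw [sub_eq_iff_eq_add.1 h1]
    abel
  have h0 : ∑ i, h i (P (x 0) : X) = 0 := by
    have : (P (x 0) : X) ∈ LinearMap.ker (∑ i, h i) := hY ▸ (P (x 0)).2
    rwa [LinearMap.mem_ker, LinearMap.sum_apply] at this
  have hsum : ∑ j, h j (P (x j) : X) = -4 := by
    rw [Fin.sum_univ_three] at h0 ⊢
    rw [hd 1, hd 2]
    simp only [map_add, map_sub, hs.apply_eq, if_true, Fin.reduceEq, if_false]
    linarith
  rw [Fin.sum_univ_three] at hsum
  linarith [hb 0, hb 1, hb 2]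

end IsExtremalSystem

theorem encard_setOf_relProjConst_eq_le (X : Type*) [NormedAddCommGroup X] [NormedSpace ℝ X]
    (hX : finrank ℝ X = 3) :
    {Y : Submodule ℝ X | finrank ℝ Y = 2 ∧ relProjConst Y = 4 / 3}.encard ≤ 4 := by
  set S := {Y : Submodule ℝ X | finrank ℝ Y = 2 ∧ relProjConst Y = 4 / 3}
  rcases S.eq_empty_or_nonempty with hS | ⟨Y₀, hY₀, hY₀c⟩
  · simp [hS]
  obtain ⟨x, h, hs, rfl⟩ := exists_isExtremalSystem hX hY₀ hY₀c
  let T : Fin 3 → Set (Submodule ℝ X) := fun k => {Y | IsExtremalSystem.IsEdgePlane x k Y}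
  have hT : ∀ k, (T k).encard ≤ 1 := fun k =>
    Set.encard_le_one_iff.2 fun Y Y' hY hY' => IsExtremalSystem.IsEdgePlane.unique hs hX hY hY'
  have hsub : S ⊆ {LinearMap.ker (∑ i, h i)} ∪ T 0 ∪ T 1 ∪ T 2 := by
    rintro Y ⟨hY, hYc⟩
    obtain ⟨x', h', hs', rfl⟩ := exists_isExtremalSystem hX hY hYc
    rcases hs.ker_eq_or_exists_isEdgePlane hX hs' with hk | ⟨k, hk⟩
    · exact Or.inl (Or.inl (Or.inl hk))
    · fin_cases k
      · exact Or.inl (Or.inl (Or.inr hk))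
      · exact Or.inl (Or.inr hk)
      · exact Or.inr hk
  calc S.encard ≤ _ := Set.encard_le_encard hsub
    _ ≤ 1 + 1 + 1 + 1 := by
        refine (Set.encard_union_le _ _).trans (add_le_add ?_ (hT 2))
        refine (Set.encard_union_le _ _).trans (add_le_add ?_ (hT 1))
        exact (Set.encard_union_le _ _).trans (add_le_add (Set.encard_singleton _).le (hT 0))
    _ = 4 := by norm_num

/-! ### The four planes of ℓ_∞^3. -/

/-- Representatives, up to sign, of the sign vectors of length three. -/
def signVector (m : Fin 4) (i : Fin 3) : ℝ := if i.succ = m then -1 else 1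

theorem signVector_mul_self (m : Fin 4) (i : Fin 3) : signVector m i * signVector m i = 1 := by
  unfold signVector
  split_ifs <;> norm_num

theorem abs_signVector (m : Fin 4) (i : Fin 3) : |signVector m i| = 1 := by
  unfold signVector
  split_ifs <;> simp

/-- The planes of `ℓ_∞^3` orthogonal to a sign vector. -/
noncomputable def signPlane (m : Fin 4) : Submodule ℝ (Fin 3 → ℝ) :=
  LinearMap.ker (∑ i, signVector m i • (LinearMap.proj i : (Fin 3 → ℝ) →ₗ[ℝ] ℝ))

theorem mem_signPlane {m : Fin 4} {v : Fin 3 → ℝ} :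
    v ∈ signPlane m ↔ ∑ i, signVector m i * v i = 0 := by
  simp [signPlane]

theorem signPlane_injective : Function.Injective signPlane := by
  intro m n h
  have key : ∀ v : Fin 3 → ℝ, ∑ i, signVector m i * v i = 0 → ∑ i, signVector n i * v i = 0 :=
    fun v hv => mem_signPlane.1 (h ▸ mem_signPlane.2 hv)
  -- The two test vectors span the plane of `m`; for n ≠ m one of them lies outside the plane of
  -- `n`.
  have h1 := key ![signVector m 0, -signVector m 1, 0] (by
    simp [Fin.sum_univ_three, signVector_mul_self])
  have h2 := key ![0, signVector m 1, -signVector m 2] (by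
    simp [Fin.sum_univ_three, signVector_mul_self])
  simp only [Fin.sum_univ_three, Matrix.cons_val] at h1 h2
  fin_cases m <;> fin_cases n <;>
    first
      | rfl
      | (exfalso; norm_num [signVector, Fin.ext_iff] at h1; done)
      | (exfalso; norm_num [signVector, Fin.ext_iff] at h2)

theorem finrank_signPlane (m : Fin 4) : finrank ℝ (signPlane m) = 2 := by
  have h0 : (∑ i, signVector m i • (LinearMap.proj i : (Fin 3 → ℝ) →ₗ[ℝ] ℝ)) ≠ 0 := by
    intro h
    have := LinearMap.congr_fun h (signVector m)
    simp [signVector_mul_self] at this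
  have h1 := Dual.finrank_ker_add_one_of_ne_zero h0
  rw [finrank_fin_fun] at h1
  exact Nat.succ_injective h1

/-- The points are the three cube vertices adjacent to the sign vector. -/
theorem isExtremalSystem_signVector (m : Fin 4) :
    IsExtremalSystem (fun (j i : Fin 3) => signVector m i * (if i = j then -1 else 1))
      fun i => signVector m i • (LinearMap.proj i : (Fin 3 → ℝ) →ₗ[ℝ] ℝ) where
  norm_le j := by
    refine (pi_norm_le_iff_of_nonneg zero_le_one).2 fun i => ?_
    rw [Real.norm_eq_abs, abs_mul, abs_signVector, one_mul]
    split_ifs <;> simp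
  abs_le i v := by
    rw [LinearMap.smul_apply, smul_eq_mul, abs_mul, abs_signVector, one_mul]
    exact norm_le_pi_norm v i
  apply_eq i j := by
    simp only [LinearMap.smul_apply, LinearMap.proj_apply, smul_eq_mul, ← mul_assoc,
      signVector_mul_self, one_mul]

/-- For a sign vector ε the projection is v ↦ v − ⟨ε, v⟩ ε / 3. Each coordinate has coefficients of
modulus 2/3, 1/3, 1/3, with sum 4/3. -/
theorem exists_mem_projectionsOnto_signPlane (m : Fin 4) :
    ∃ P ∈ projectionsOnto (signPlane m), ‖P‖ ≤ 4 / 3 := by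
  let f : (Fin 3 → ℝ) →ₗ[ℝ] ℝ := ∑ i, signVector m i • LinearMap.proj i
  have hf : ∀ v, f v = ∑ i, signVector m i * v i := fun v => by simp [f]
  let Q : (Fin 3 → ℝ) →ₗ[ℝ] (Fin 3 → ℝ) :=
    LinearMap.id - f.smulRight ((1 / 3 : ℝ) • signVector m)
  have hQ : ∀ v i, Q v i = v i - f v * (1 / 3 * signVector m i) := fun v i => by simp [Q]
  have hmem : ∀ v, Q v ∈ signPlane m := by
    intro v
    rw [mem_signPlane]
    have e := hf v
    rw [Fin.sum_univ_three] at e ⊢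
    rw [hQ, hQ, hQ]
    linear_combination -e + (-(f v) / 3) *
      (signVector_mul_self m 0 + signVector_mul_self m 1 + signVector_mul_self m 2)
  let P : (Fin 3 → ℝ) →L[ℝ] signPlane m := LinearMap.toContinuousLinearMap (Q.codRestrict _ hmem)
  refine ⟨P, fun y => Subtype.ext (funext fun i => ?_), ?_⟩
  · have hy : f y = 0 := y.2
    change Q y i = _
    rw [hQ, hy, zero_mul, sub_zero]
  · refine P.opNorm_le_bound (by norm_num) fun v => ?_
    change ‖Q v‖ ≤ _
    refine (pi_norm_le_iff_of_nonneg (by positivity)).2 fun i => ?_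
    rw [Real.norm_eq_abs, hQ, hf]
    have hv : ∀ j, |signVector m j * v j| ≤ ‖v‖ := fun j => by
      rw [abs_mul, abs_signVector, one_mul]
      exact norm_le_pi_norm v j
    have e : v i - (∑ j, signVector m j * v j) * (1 / 3 * signVector m i) =
        signVector m i * (signVector m i * v i - 1 / 3 * ∑ j, signVector m j * v j) := by
      linear_combination -v i * signVector_mul_self m i
    rw [e, abs_mul, abs_signVector, one_mul]
    obtain ⟨a, b, -, -, -, -, hsum⟩ := exists_sum_eq_add_add i
    rw [hsum]
    have hi := abs_le.1 (hv i)
    have ha := abs_le.1 (hv a)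
    have hb := abs_le.1 (hv b)
    rw [abs_le]
    constructor <;> linarith

theorem relProjConst_signPlane (m : Fin 4) : relProjConst (signPlane m) = 4 / 3 := by
  obtain ⟨P, hP, hPn⟩ := exists_mem_projectionsOnto_signPlane m
  refine le_antisymm ((relProjConst_le _ hP).trans hPn) ?_
  refine le_csInf ((projectionsOnto_nonempty _).image _) ?_
  rintro _ ⟨Q, hQ, rfl⟩
  exact (isExtremalSystem_signVector m).four_thirds_le_norm rfl hQ

theorem theorem3p2 :
    (∀ (X : Type*) [NormedAddCommGroup X] [NormedSpace ℝ X], Module.finrank ℝ X = 3 →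
      {Y : Submodule ℝ X | Module.finrank ℝ Y = 2 ∧ relProjConst Y = 4 / 3}.encard ≤ 4) ∧
    -- `Fin 3 → ℝ` carries the sup norm, so it is the space `ℓ_∞^3`
    {Y : Submodule ℝ (Fin 3 → ℝ) |
      Module.finrank ℝ Y = 2 ∧ relProjConst Y = 4 / 3}.encard = 4 := by
  refine ⟨fun X _ _ hX => encard_setOf_relProjConst_eq_le X hX,
    le_antisymm (encard_setOf_relProjConst_eq_le _ (by simp)) ?_⟩
  calc (4 : ℕ∞) = (Set.range signPlane).encard := by
        rw [← Set.image_univ, signPlane_injective.encard_image, Set.encard_univ]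
        simp
    _ ≤ _ := by
        refine Set.encard_le_encard ?_
        rintro _ ⟨m, rfl⟩
        exact ⟨finrank_signPlane m, relProjConst_signPlane m⟩
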